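/- Fix an integer $k\ge 0$. Let $\mathcal L$ be the set of lines of slope $0$, $-1$ and $\infty$ through points of $\mathbb Z^2$, each cut into segments between consecutive integral points. To an oriented curve $\gamma$ in $\mathbb R^2$ associate the poset $\mathcal P_\gamma$ with elements $(\tau,0),\dots,(\tau,k)$ for each crossing of $\gamma$ with a segment $\tau$ of $\mathcal L$, generated by the following relations. If the crossing point lies strictly closer to the endpoint of $\tau$ to the right of $\gamma$, then $(\tau,0)\succ(\tau,1)\succ\cdots\succ(\tau,k)$; otherwise $(\tau,0)\prec(\tau,1)\prec\cdots\prec(\tau,k)$. If $\gamma$ crosses $\tau$ and $\tau'$ consecutively in this order, then $(\tau,k)\succ(\tau',0)$ if their common endpoint is to the right of $\gamma$, and $(\tau,k)\prec(\tau',0)$ if it is to the left of $\gamma$. For $(p,q)\in\mathbb Z^2\setminus\{(0,0)\}$ let $\gamma^L_{(p,q)}$ be the straight line segment from $(0,0)$ to $(p,q)$, deformed slightly with its endpoints fixed so that it passes to the left of every point of $(\tfrac12\mathbb Z)^2$ in its interior, and let $m^{(k)}_{(p,q)}$ be the number of order ideals (downwards closed subsets, including the empty one) of $\mathcal P_{\gamma^L_{(p,q)}}$.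 Then for all $n\ge 1$, \[ m^{(k)}_{(n,1)}=(k+1)\,m^{(k)}_{(n,0)}+m^{(k)}_{(n-1,1)} \qquad\text{and}\qquad m^{(k)}_{(n+1,n)}=2(k+1)\,m^{(k)}_{(n,n)}+m^{(k)}_{(n,n-1)}. \] -/

import Mathlib

open scoped Topology

/-- An integral point, viewed in the real plane. -/
def latticePoint (a : ℤ × ℤ) : ℝ × ℝ := ((a.1 : ℝ), (a.2 : ℝ))

/-- Two integral points are the endpoints of a segment of the lattice `𝓛` (the lines of slope
`0`, `-1` and `∞` through integral points, cut into segments between consecutive integral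
points). -/
def LatticeAdj (a b : ℤ × ℤ) : Prop :=
  b - a = (1, 0) ∨ b - a = (-1, 0) ∨ b - a = (0, 1) ∨ b - a = (0, -1) ∨
    b - a = (1, -1) ∨ b - a = (-1, 1)

/-- `det (l - r, x - r)`: positive if `x` lies to the left of the line directed from `r` to `l`,
negative if `x` lies to its right. -/
def sideOf (l r : ℤ × ℤ) (x : ℝ × ℝ) : ℝ :=
  ((l.1 : ℝ) - r.1) * (x.2 - r.2) - ((l.2 : ℝ) - r.2) * (x.1 - r.1)

/-- An intersection of the oriented curve `γ` (parametrized by `[0, 1]`) with a segment of `𝓛`: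
at the given time the curve passes through the relative interior of the segment, from one side to
the other, the endpoint `left` being to the left of `γ` and the endpoint `right` to its right. -/
structure Crossing (γ : ℝ → ℝ × ℝ) where
  time : ℝ
  left : ℤ × ℤ
  right : ℤ × ℤ
  time_mem : time ∈ Set.Ioo (0 : ℝ) 1
  adj : LatticeAdj left right
  mem_segment : γ time ∈ openSegment ℝ (latticePoint left) (latticePoint right)
  before : ∀ᶠ s in 𝓝[<] time, 0 < sideOf left right (γ s)
  after : ∀ᶠ s in 𝓝[>] time, sideOf left right (γ s) < 0

namespace Crossing

variable {γ : ℝ → ℝ × ℝ}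

/-- The intersection point lies strictly closer to the right endpoint of the segment. (The point
is on the segment, so all norms on the plane give the same comparison.) -/
def CloserToRight (c : Crossing γ) : Prop :=
  dist (γ c.time) (latticePoint c.right) < dist (γ c.time) (latticePoint c.left)

/-- `γ` crosses the segments of `c` and `c'` consecutively, in this order. -/
def Consecutive (c c' : Crossing γ) : Prop :=
  c.time < c'.time ∧ ∀ d : Crossing γ, ¬ (c.time < d.time ∧ d.time < c'.time)

end Crossing

/-- The underlying set of the poset `𝓟_γ`: a chain of `k + 1` elements for every intersection
of `γ` with a segment of `𝓛`. -/
def CurvePoset (k : ℕ) (γ : ℝ → ℝ × ℝ) : Type := Crossing γ × Fin (k + 1)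

/-- The relations that define `𝓟_γ`; `CurvePoset.Step k γ x y` says `x ≺ y`. -/
inductive CurvePoset.Step (k : ℕ) (γ : ℝ → ℝ × ℝ) : CurvePoset k γ → CurvePoset k γ → Prop
  /-- `(τ, 0) ≻ (τ, 1) ≻ ⋯ ≻ (τ, k)` -/
  | chain_right (c : Crossing γ) (h : c.CloserToRight) (i : Fin k) :
      CurvePoset.Step k γ (c, i.succ) (c, i.castSucc)
  /-- `(τ, 0) ≺ (τ, 1) ≺ ⋯ ≺ (τ, k)` -/
  | chain_left (c : Crossing γ) (h : ¬ c.CloserToRight) (i : Fin k) :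
      CurvePoset.Step k γ (c, i.castSucc) (c, i.succ)
  /-- `(τ, k) ≻ (τ', 0)` if the common endpoint of `τ` and `τ'` is to the right of `γ` -/
  | link_right (c c' : Crossing γ) (h : c.Consecutive c') (hr : c.right = c'.right) :
      CurvePoset.Step k γ (c', 0) (c, Fin.last k)
  /-- `(τ, k) ≺ (τ', 0)` if the common endpoint of `τ` and `τ'` is to the left of `γ` -/
  | link_left (c c' : Crossing γ) (h : c.Consecutive c') (hl : c.left = c'.left) :
      CurvePoset.Step k γ (c, Fin.last k) (c', 0)

/-- The order of `𝓟_γ`: the reflexive and transitive closure of the defining relations. -/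
instance (k : ℕ) (γ : ℝ → ℝ × ℝ) : Preorder (CurvePoset k γ) where
  le := Relation.ReflTransGen (CurvePoset.Step k γ)
  le_refl _ := Relation.ReflTransGen.refl
  le_trans _ _ _ := Relation.ReflTransGen.trans

/-- The curve `γ^L_{(p,q)}`: the line segment from `(0, 0)` to `(p, q)`, pushed slightly to the
left of its direction (the vector `(-q, p)` points to the left), with its endpoints fixed.
It is at distance at most `1 / (16 √(p² + q²))` from the line segment, whereas a point of
`(½ℤ)²` off the line through `(0, 0)` and `(p, q)` is at distance at least `1 / (2 √(p² + q²))`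
from that line. So the points of `(½ℤ)²` inside the line segment come to lie to the right of the
curve, and no other point of `(½ℤ)²` changes sides. -/
noncomputable def leftCurve (p q : ℤ) (t : ℝ) : ℝ × ℝ :=
  (t * p - t * (1 - t) / (4 * ((p : ℝ) ^ 2 + (q : ℝ) ^ 2)) * q,
   t * q + t * (1 - t) / (4 * ((p : ℝ) ^ 2 + (q : ℝ) ^ 2)) * p)

/-- `m^{(k)}_{(p,q)}`: the number of order ideals (downwards closed subsets) of the poset
`𝓟_{(p,q)}` of the curve `γ^L_{(p,q)}`. -/
noncomputable def kMarkov (k : ℕ) (p q : ℤ) : ℕ :=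
  Nat.card (LowerSet (CurvePoset k (leftCurve p q)))

/-!
The poset `𝓟_γ` is a fence, so its ideals are counted by transfer vectors: if `(x, y)` counts the
ideals that avoid, respectively contain, the last element, then a new element below it turns
`(x, y)` into `(x, x + y)` and a new element above it turns `(x, y)` into `(x + y, y)`. The segments
that `γ^L_{(p,q)}` crosses follow the staircase of the integral points
`(s - ⌊qs/(p+q)⌋, ⌊qs/(p+q)⌋)` next to the curve on its right.

If `p` and `q` are coprime, the rotation by `π` about the midpoint of the curve reverses all
relations except those of the middle chain, so there are `x² + kxy + y²` ideals, where `(x, y)` is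
the vector of half of the fence. For `(n, 1)` the half fence is an initial part of the fence of
`(n, 0)`, and for `(n + 1, n)` it is dual to an initial part of the fence of `(n, n)`. Thus each
recurrence expresses the difference of the form `x² + kxy + y²` at consecutive initial parts by the
addition formula of a linear recursion.
-/

/-- The effect of appending one element to a fence on the pair (number of ideals avoiding the last
element, number of ideals containing it); `d = true` means that the new element is below the last
one. -/
def fenceStep (d : Bool) (x : ℕ × ℕ) : ℕ × ℕ :=
  bif d then (x.1, x.1 + x.2) else (x.1 + x.2, x.2)

/-- The transfer vector of the fence on `0, …, m` in which `i + 1 ≺ i` if `e i`, and `i ≺ i + 1`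
otherwise: the numbers of its ideals that avoid, respectively contain, `m`. -/
def fenceVec (e : ℕ → Bool) : ℕ → ℕ × ℕ
  | 0 => (1, 1)
  | m + 1 => fenceStep (e m) (fenceVec e m)

/-- The condition that a relation of a fence in direction `d` imposes on the indicator function of
an ideal at the two elements concerned. -/
def FenceRel (d a b : Bool) : Prop :=
  bif d then a ≤ b else b ≤ a

/-- `f` is the indicator function of an ideal of the fence on `0, …, M` with directions `e`. -/
def IsFenceIdeal (e : ℕ → Bool) {M : ℕ} (f : Fin (M + 1) → Bool) : Prop :=
  ∀ m : Fin M, FenceRel (e m) (f m.castSucc) (f m.succ)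

theorem isFenceIdeal_snoc {e : ℕ → Bool} {M : ℕ} {f : Fin (M + 1) → Bool} {b : Bool} :
    IsFenceIdeal e (Fin.snoc f b : Fin (M + 2) → Bool) ↔
      IsFenceIdeal e f ∧ FenceRel (e M) (f (Fin.last M)) b := by
  simp only [IsFenceIdeal, Fin.forall_fin_succ', Fin.snoc_castSucc, Fin.succ_castSucc,
    Fin.succ_last, Fin.snoc_last, Fin.val_castSucc, Fin.val_last]

open Classical in
theorem card_isFenceIdeal_last_succ (e : ℕ → Bool) (M : ℕ) (b : Bool) :
    Finset.card {f : Fin (M + 2) → Bool | IsFenceIdeal e f ∧ f (Fin.last (M + 1)) = b} =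
      Finset.card {f : Fin (M + 1) → Bool |
        IsFenceIdeal e f ∧ FenceRel (e M) (f (Fin.last M)) b} := by
  refine Finset.card_nbij' Fin.init (fun f => Fin.snoc f b) ?_ ?_ ?_ ?_
  · rintro f hf
    obtain ⟨ideal, rfl⟩ : IsFenceIdeal e f ∧ f (Fin.last (M + 1)) = b := by simpa using hf
    rw [← Fin.snoc_init_self f, isFenceIdeal_snoc] at ideal
    simpa using ideal
  · intro f hf
    simpa [isFenceIdeal_snoc] using hf
  · rintro f hf
    obtain ⟨-, rfl⟩ : IsFenceIdeal e f ∧ f (Fin.last (M + 1)) = b := by simpa using hf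
    exact Fin.snoc_init_self f
  · intro f _
    exact Fin.init_snoc (α := fun _ => Bool) b f

open Classical in
theorem card_isFenceIdeal_eq_add (e : ℕ → Bool) (M : ℕ) :
    Finset.card {f : Fin (M + 1) → Bool | IsFenceIdeal e f} =
      Finset.card {f : Fin (M + 1) → Bool | IsFenceIdeal e f ∧ f (Fin.last M) = false} +
        Finset.card {f : Fin (M + 1) → Bool | IsFenceIdeal e f ∧ f (Fin.last M) = true} := by
  rw [← Finset.card_filter_add_card_filter_not (fun f => f (Fin.last M) = false)]
  simp only [Finset.filter_filter, Bool.not_eq_false]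

open Classical in
theorem card_isFenceIdeal_last (e : ℕ → Bool) (M : ℕ) :
    Finset.card {f : Fin (M + 1) → Bool | IsFenceIdeal e f ∧ f (Fin.last M) = false} =
        (fenceVec e M).1 ∧
      Finset.card {f : Fin (M + 1) → Bool | IsFenceIdeal e f ∧ f (Fin.last M) = true} =
        (fenceVec e M).2 := by
  induction M with
  | zero =>
    have card_eq_one (b : Bool) :
        Finset.card {f : Fin 1 → Bool | IsFenceIdeal e f ∧ f (Fin.last 0) = b} = 1 := by
      refine Finset.card_eq_one.2 ⟨fun _ => b, ?_⟩
      ext f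
      simp [IsFenceIdeal, funext_iff]
    exact ⟨card_eq_one false, card_eq_one true⟩
  | succ M ih =>
    rw [card_isFenceIdeal_last_succ, card_isFenceIdeal_last_succ, fenceVec, ← Prod.mk.eta
      (p := fenceVec e M), ← ih.1, ← ih.2]
    have true_le (a : Bool) : true ≤ a ↔ a = true := by cases a <;> decide
    have le_false (a : Bool) : a ≤ false ↔ a = false := by cases a <;> decide
    cases e M <;> simp [FenceRel, fenceStep, card_isFenceIdeal_eq_add, true_le, le_false]

open Classical in
theorem card_isFenceIdeal (e : ℕ → Bool) (M : ℕ) :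
    Finset.card {f : Fin (M + 1) → Bool | IsFenceIdeal e f} =
      (fenceVec e M).1 + (fenceVec e M).2 := by
  rw [card_isFenceIdeal_eq_add, (card_isFenceIdeal_last e M).1, (card_isFenceIdeal_last e M).2]

open Classical in
theorem card_lowerSet_eq_fenceVec {α : Type*} [Preorder α] {M : ℕ} {x : Fin (M + 1) → α}
    (hx : Function.Bijective x) {e : ℕ → Bool}
    (hlower : ∀ S : Set α, IsLowerSet S ↔ IsFenceIdeal e fun m => decide (x m ∈ S)) :
    Nat.card (LowerSet α) = (fenceVec e M).1 + (fenceVec e M).2 := by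
  rw [← card_isFenceIdeal, ← Nat.card_eq_finsetCard]
  refine Nat.card_eq_of_bijective (fun S => ⟨fun m => decide (x m ∈ S), ?_⟩) ⟨?_, ?_⟩
  · simpa using (hlower S).1 S.lower
  · intro S S' hSS'
    refine SetLike.ext (hx.surjective.forall.2 fun m => ?_)
    simpa using congrFun (congrArg Subtype.val hSS') m
  · rintro ⟨f, hf⟩
    have indicator_eq : (fun m => decide (x m ∈ x '' {m | f m = true})) = f := by
      funext m
      simp [hx.injective.eq_iff]
    refine ⟨⟨x '' {m | f m = true}, (hlower _).2 ?_⟩, Subtype.ext indicator_eq⟩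
    rw [indicator_eq]
    simpa using hf

/-- The transfer vector, after the first element of the `i`-th chain, of the fence that consists of
chains of `k + 1` elements, the `i`-th one having direction `d i` and being linked to the next one
in direction `s i`. -/
def chainVec (k : ℕ) (d s : ℕ → Bool) : ℕ → ℕ × ℕ
  | 0 => (1, 1)
  | i + 1 => fenceStep (s i) ((fenceStep (d i))^[k] (chainVec k d s i))

/-- The number of ideals of the fence of `chainVec` that consists of the chains `0, …, N`. -/
def chainFenceCard (k : ℕ) (d s : ℕ → Bool) (N : ℕ) : ℕ :=
  ((fenceStep (d N))^[k] (chainVec k d s N)).1 + ((fenceStep (d N))^[k] (chainVec k d s N)).2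

/-- The directions of the fence of `chainVec`, whose elements are numbered so that
`i * (k + 1) + j` is the `j`-th element of the `i`-th chain. -/
def chainDir (k : ℕ) (d s : ℕ → Bool) (m : ℕ) : Bool :=
  if m % (k + 1) = k then s (m / (k + 1)) else d (m / (k + 1))

theorem mul_succ_add_div {k j : ℕ} (hj : j ≤ k) (i : ℕ) : (i * (k + 1) + j) / (k + 1) = i := by
  rw [mul_comm, Nat.mul_add_div k.succ_pos, Nat.div_eq_of_lt (by lia), add_zero]

theorem mul_succ_add_mod {k j : ℕ} (hj : j ≤ k) (i : ℕ) : (i * (k + 1) + j) % (k + 1) = j := by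
  rw [mul_comm, Nat.mul_add_mod, Nat.mod_eq_of_lt (by lia)]

theorem chainDir_of_lt {k j : ℕ} (d s : ℕ → Bool) (hj : j < k) (i : ℕ) :
    chainDir k d s (i * (k + 1) + j) = d i := by
  rw [chainDir, mul_succ_add_div hj.le, mul_succ_add_mod hj.le, if_neg hj.ne]

theorem chainDir_last (k : ℕ) (d s : ℕ → Bool) (i : ℕ) :
    chainDir k d s (i * (k + 1) + k) = s i := by
  rw [chainDir, mul_succ_add_div le_rfl, mul_succ_add_mod le_rfl, if_pos rfl]

theorem fenceVec_add_of_forall_eq {e : ℕ → Bool} {d : Bool} {m t : ℕ}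
    (h : ∀ j < t, e (m + j) = d) : fenceVec e (m + t) = (fenceStep d)^[t] (fenceVec e m) := by
  induction t with
  | zero => rfl
  | succ t ih =>
    rw [← add_assoc, fenceVec, ih fun j hj => h j (by lia), h t (by lia),
      Function.iterate_succ_apply']

theorem fenceVec_chainDir (k : ℕ) (d s : ℕ → Bool) (i : ℕ) :
    fenceVec (chainDir k d s) (i * (k + 1)) = chainVec k d s i := by
  induction i with
  | zero => rw [zero_mul, fenceVec, chainVec]
  | succ i ih =>
    rw [add_one_mul, ← add_assoc, fenceVec, chainDir_last,
      fenceVec_add_of_forall_eq fun j hj => chainDir_of_lt d s hj i, ih, chainVec]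

theorem fenceVec_chainDir_total (k : ℕ) (d s : ℕ → Bool) (N : ℕ) :
    (fenceVec (chainDir k d s) (N * (k + 1) + k)).1 +
      (fenceVec (chainDir k d s) (N * (k + 1) + k)).2 = chainFenceCard k d s N := by
  rw [fenceVec_add_of_forall_eq fun j hj => chainDir_of_lt d s hj N, fenceVec_chainDir,
    chainFenceCard]

theorem chainVec_congr {k m : ℕ} {d s d' s' : ℕ → Bool} (hd : ∀ i < m, d i = d' i)
    (hs : ∀ i < m, s i = s' i) : chainVec k d s m = chainVec k d' s' m := by
  induction m with
  | zero => rfl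
  | succ m ih =>
    rw [chainVec, chainVec, ih (fun i hi => hd i (by lia)) (fun i hi => hs i (by lia)),
      hd m (by lia), hs m (by lia)]

theorem chainVec_not (k : ℕ) (d s : ℕ → Bool) (m : ℕ) :
    chainVec k (fun i => !d i) (fun i => !s i) m = (chainVec k d s m).swap := by
  have fenceStep_not (d : Bool) : Function.Semiconj Prod.swap (fenceStep d) (fenceStep !d) := by
    intro x
    cases d <;> simp [fenceStep, add_comm]
  induction m with
  | zero => rfl
  | succ m ih =>
    rw [chainVec, chainVec, ih, ← (fenceStep_not _).iterate_right k, ← fenceStep_not]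

theorem chainFenceCard_congr {k N : ℕ} {d s d' s' : ℕ → Bool} (hd : ∀ i ≤ N, d i = d' i)
    (hs : ∀ i < N, s i = s' i) : chainFenceCard k d s N = chainFenceCard k d' s' N := by
  rw [chainFenceCard, chainFenceCard, chainVec_congr (fun i hi => hd i hi.le) hs, hd N le_rfl]

theorem fenceStep_true_iterate (j : ℕ) (x : ℕ × ℕ) :
    (fenceStep true)^[j] x = (x.1, x.2 + j * x.1) := by
  induction j with
  | zero => simp
  | succ j ih =>
    rw [Function.iterate_succ_apply', ih]
    simp only [fenceStep, cond_true, Prod.mk.injEq, true_and]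
    ring

theorem fenceStep_false_iterate (j : ℕ) (x : ℕ × ℕ) :
    (fenceStep false)^[j] x = (x.1 + j * x.2, x.2) := by
  induction j with
  | zero => simp
  | succ j ih =>
    rw [Function.iterate_succ_apply', ih]
    simp only [fenceStep, cond_false, Prod.mk.injEq, and_true]
    ring

/-- The number of ideals of two fences joined at their last elements, in terms of their transfer
vectors. -/
def pairing (x y : ℕ × ℕ) : ℕ := x.1 * y.1 + x.2 * y.2

theorem pairing_fenceStep (d : Bool) (x y : ℕ × ℕ) :
    pairing (fenceStep d x) y = pairing x (fenceStep (!d) y) := by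
  cases d <;> simp [pairing, fenceStep] <;> ring

theorem pairing_fenceStep_iterate (d : Bool) (j : ℕ) (x y : ℕ × ℕ) :
    pairing ((fenceStep d)^[j] x) y = pairing x ((fenceStep (!d))^[j] y) := by
  induction j generalizing y with
  | zero => rfl
  | succ j ih =>
    rw [Function.iterate_succ_apply', pairing_fenceStep, ih, Function.iterate_succ_apply]

/-- The number of ideals of an antisymmetric fence, in terms of the transfer vector of its first
half. -/
def halfForm (k : ℕ) (x : ℕ × ℕ) : ℕ := x.1 ^ 2 + k * x.1 * x.2 + x.2 ^ 2

theorem halfForm_swap (k : ℕ) (x : ℕ × ℕ) : halfForm k x.swap = halfForm k x := by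
  simp only [halfForm, Prod.fst_swap, Prod.snd_swap]
  ring

theorem chainFenceCard_eq_pairing {k N j : ℕ} {d s : ℕ → Bool}
    (hd : ∀ i < j, d (N - i) = !d i) (hs : ∀ i < j, s (N - 1 - i) = !s i) (hj : j ≤ N) :
    chainFenceCard k d s N =
      pairing ((fenceStep (d (N - j)))^[k] (chainVec k d s (N - j))) (chainVec k d s j) := by
  induction j with
  | zero => simp [chainFenceCard, pairing, chainVec]
  | succ j ih =>
    have split_last : N - j = N - (j + 1) + 1 := by lia
    rw [ih (fun i hi => hd i (by lia)) (fun i hi => hs i (by lia)) (by lia),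
      pairing_fenceStep_iterate, hd j (by lia), split_last, chainVec, pairing_fenceStep,
      show N - (j + 1) = N - 1 - j by lia, hs j (by lia), Bool.not_not, Bool.not_not, chainVec]

theorem chainFenceCard_eq_halfForm {k m : ℕ} {d s : ℕ → Bool} (hm : d m = false)
    (hd : ∀ i < m, d (2 * m - i) = !d i) (hs : ∀ i < m, s (2 * m - 1 - i) = !s i) :
    chainFenceCard k d s (2 * m) = halfForm k (chainVec k d s m) := by
  rw [chainFenceCard_eq_pairing hd hs (by lia), show 2 * m - m = m by lia, hm,
    fenceStep_false_iterate, pairing, halfForm]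
  ring

theorem forall_lt_mul_succ_add_iff {N k : ℕ} {P : ℕ → Prop} :
    (∀ m < N * (k + 1) + k, P m) ↔
      (∀ i ≤ N, ∀ j < k, P (i * (k + 1) + j)) ∧ ∀ i < N, P (i * (k + 1) + k) := by
  refine ⟨fun h => ⟨fun i hi j hj => h _ ?_, fun i hi => h _ ?_⟩, fun ⟨chain, link⟩ m hm => ?_⟩
  · nlinarith
  · nlinarith
  · have hi : m / (k + 1) < N + 1 := Nat.div_lt_of_lt_mul (by nlinarith)
    rw [← Nat.div_add_mod' m (k + 1)] at hm ⊢
    rcases (Nat.lt_succ_iff.1 (Nat.mod_lt m k.succ_pos)).lt_or_eq with hj | hj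
    · exact chain _ (by lia) _ hj
    · rw [hj] at hm ⊢
      exact link _ (lt_of_mul_lt_mul_right (by lia : _ * (k + 1) < _) (Nat.zero_le _))

section CurvePoset

variable {γ : ℝ → ℝ × ℝ}

theorem fenceRel_decide {d : Bool} {P Q : Prop} [Decidable P] [Decidable Q] :
    FenceRel d (decide P) (decide Q) ↔ (d = true → P → Q) ∧ (d = false → Q → P) := by
  cases d <;> simp [FenceRel, Bool.le_iff_imp]

theorem isLowerSet_curvePoset_iff {k : ℕ} {S : Set (CurvePoset k γ)} :
    IsLowerSet S ↔ ∀ x y, CurvePoset.Step k γ x y → y ∈ S → x ∈ S := by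
  refine ⟨fun h x y hxy hy => h (Relation.ReflTransGen.single hxy) hy, fun h y x hxy => ?_⟩
  induction (hxy : Relation.ReflTransGen (CurvePoset.Step k γ) x y) with
  | refl => exact id
  | tail _ hzy ih => exact fun hy => ih (h _ _ hzy hy)

/-- The element `(τ, j)` of `𝓟_γ`, `x` being the crossing of `γ` with `τ`. -/
def CurvePoset.mk {k : ℕ} (x : Crossing γ) (j : Fin (k + 1)) : CurvePoset k γ := (x, j)

/-- The `m`-th element of `𝓟_γ` along the curve, `c i` being its `i`-th crossing. -/
def curvePoint (k : ℕ) (c : ℕ → Crossing γ) (m : ℕ) : CurvePoset k γ :=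
  CurvePoset.mk (c (m / (k + 1))) ⟨m % (k + 1), Nat.mod_lt _ k.succ_pos⟩

theorem curvePoint_mul_succ_add {k j : ℕ} (c : ℕ → Crossing γ) (i : ℕ) (hj : j < k + 1) :
    curvePoint k c (i * (k + 1) + j) = CurvePoset.mk (c i) ⟨j, hj⟩ :=
  Prod.ext (congrArg c (mul_succ_add_div (by lia) i)) (Fin.ext (mul_succ_add_mod (by lia) i))

/-- `c 0, …, c N` are all crossings of the curve in their order, `d i` tells whether `c i` is
closer to its right endpoint, and `s i` whether `c i` and `c (i + 1)` share their right or their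
left endpoint. -/
structure CrossingSequence (N : ℕ) (c : ℕ → Crossing γ) (d s : ℕ → Bool) : Prop where
  time_lt : ∀ i < N, (c i).time < (c (i + 1)).time
  surj : ∀ x, ∃ i ≤ N, c i = x
  closer : ∀ i ≤ N, (c i).CloserToRight ↔ d i = true
  right_eq : ∀ i < N, (c i).right = (c (i + 1)).right ↔ s i = true
  left_eq : ∀ i < N, (c i).left = (c (i + 1)).left ↔ s i = false

namespace CrossingSequence

variable {N : ℕ} {c : ℕ → Crossing γ} {d s : ℕ → Bool}

theorem time_strictMonoOn (h : CrossingSequence N c d s) :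
    StrictMonoOn (fun i => (c i).time) (Set.Iic N) :=
  strictMonoOn_of_lt_add_one Set.ordConnected_Iic fun i _ _ hi => h.time_lt i hi

theorem injOn (h : CrossingSequence N c d s) : Set.InjOn c (Set.Iic N) := fun _ hi _ hj hij =>
  h.time_strictMonoOn.injOn hi hj (congrArg Crossing.time hij)

theorem consecutive_iff (h : CrossingSequence N c d s) {i j : ℕ} (hi : i ≤ N) (hj : j ≤ N) :
    (c i).Consecutive (c j) ↔ j = i + 1 := by
  have time_lt_iff {a b : ℕ} (ha : a ≤ N) (hb : b ≤ N) : (c a).time < (c b).time ↔ a < b :=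
    h.time_strictMonoOn.lt_iff_lt ha hb
  unfold Crossing.Consecutive
  rw [time_lt_iff hi hj]
  constructor
  · rintro ⟨hij, none_between⟩
    by_contra hne
    refine none_between (c (i + 1)) ?_
    rw [time_lt_iff hi (by lia), time_lt_iff (by lia) hj]
    lia
  · rintro rfl
    refine ⟨by lia, fun x => ?_⟩
    obtain ⟨l, hl, rfl⟩ := h.surj x
    rw [time_lt_iff hi hl, time_lt_iff hl hj]
    lia

open Classical in
theorem isLowerSet_iff (h : CrossingSequence N c d s) {k : ℕ} {S : Set (CurvePoset k γ)} :
    IsLowerSet S ↔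
      (∀ i ≤ N, ∀ j : Fin k, FenceRel (d i) (decide (CurvePoset.mk (c i) j.castSucc ∈ S))
        (decide (CurvePoset.mk (c i) j.succ ∈ S))) ∧
      ∀ i < N, FenceRel (s i) (decide (CurvePoset.mk (c i) (Fin.last k) ∈ S))
        (decide (CurvePoset.mk (c (i + 1)) 0 ∈ S)) := by
  simp only [isLowerSet_curvePoset_iff, fenceRel_decide]
  constructor
  · intro hS
    refine ⟨fun i hi j => ⟨fun hd => ?_, fun hd => ?_⟩, fun i hi => ⟨fun hs => ?_, fun hs => ?_⟩⟩
    · exact hS _ _ (.chain_right (c i) ((h.closer i hi).2 hd) j)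
    · exact hS _ _ (.chain_left (c i) (by simp [h.closer i hi, hd]) j)
    · exact hS _ _ (.link_right _ _ ((h.consecutive_iff hi.le hi).2 rfl) ((h.right_eq i hi).2 hs))
    · exact hS _ _ (.link_left _ _ ((h.consecutive_iff hi.le hi).2 rfl) ((h.left_eq i hi).2 hs))
  · rintro ⟨chain, link⟩ x y hxy
    cases hxy with
    | chain_right x hx j =>
      obtain ⟨i, hi, rfl⟩ := h.surj x
      exact (chain i hi j).1 ((h.closer i hi).1 hx)
    | chain_left x hx j =>
      obtain ⟨i, hi, rfl⟩ := h.surj x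
      exact (chain i hi j).2 (by simpa [h.closer i hi] using hx)
    | link_right x x' hx hr =>
      obtain ⟨i, hi, rfl⟩ := h.surj x
      obtain ⟨j, hj, rfl⟩ := h.surj x'
      obtain rfl := (h.consecutive_iff hi hj).1 hx
      exact (link i hj).1 ((h.right_eq i hj).1 hr)
    | link_left x x' hx hl =>
      obtain ⟨i, hi, rfl⟩ := h.surj x
      obtain ⟨j, hj, rfl⟩ := h.surj x'
      obtain rfl := (h.consecutive_iff hi hj).1 hx
      exact (link i hj).2 ((h.left_eq i hj).1 hl)

open Classical in
theorem isLowerSet_iff_isFenceIdeal (h : CrossingSequence N c d s) {k : ℕ}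
    (S : Set (CurvePoset k γ)) :
    IsLowerSet S ↔ IsFenceIdeal (chainDir k d s)
      fun m : Fin (N * (k + 1) + k + 1) => decide (curvePoint k c m ∈ S) := by
  have next_chain (i : ℕ) : curvePoint k c (i * (k + 1) + k + 1) = CurvePoset.mk (c (i + 1)) 0 := by
    rw [add_assoc, ← add_one_mul]
    exact curvePoint_mul_succ_add c (i + 1) k.succ_pos
  rw [h.isLowerSet_iff, IsFenceIdeal, Fin.forall_iff]
  refine Iff.trans ?_ (forall_lt_mul_succ_add_iff (P := fun m =>
    FenceRel (chainDir k d s m) (decide (curvePoint k c m ∈ S))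
      (decide (curvePoint k c (m + 1) ∈ S)))).symm
  refine and_congr (forall₂_congr fun i _ => ?_) (forall₂_congr fun i _ => ?_)
  · rw [Fin.forall_iff]
    refine forall₂_congr fun j hj => ?_
    rw [chainDir_of_lt d s hj, add_assoc, curvePoint_mul_succ_add c i (by lia : j < k + 1),
      curvePoint_mul_succ_add c i (by lia : j + 1 < k + 1)]
    rfl
  · rw [chainDir_last, next_chain, curvePoint_mul_succ_add c i k.lt_succ_self]
    rfl

theorem bijective_curvePoint (h : CrossingSequence N c d s) (k : ℕ) :
    Function.Bijective fun m : Fin (N * (k + 1) + k + 1) => curvePoint k c m := by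
  constructor
  · intro m m' hmm'
    have div_le (m : Fin (N * (k + 1) + k + 1)) : (m : ℕ) / (k + 1) ≤ N :=
      Nat.lt_succ_iff.1 (Nat.div_lt_of_lt_mul (by have := m.2; nlinarith))
    have div_eq := h.injOn (div_le m) (div_le m') (congrArg Prod.fst hmm')
    have mod_eq : (m : ℕ) % (k + 1) = m' % (k + 1) := Fin.val_eq_of_eq (congrArg Prod.snd hmm')
    rw [Fin.ext_iff, ← Nat.div_add_mod m (k + 1), div_eq, mod_eq, Nat.div_add_mod]
  · rintro ⟨x, j⟩
    obtain ⟨i, hi, rfl⟩ := h.surj x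
    exact ⟨⟨i * (k + 1) + j, by have := j.2; nlinarith⟩, curvePoint_mul_succ_add c i j.2⟩

theorem card_lowerSet (h : CrossingSequence N c d s) (k : ℕ) :
    Nat.card (LowerSet (CurvePoset k γ)) = chainFenceCard k d s N := by
  rw [card_lowerSet_eq_fenceVec (h.bijective_curvePoint k) h.isLowerSet_iff_isFenceIdeal,
    fenceVec_chainDir_total]

end CrossingSequence

end CurvePoset

section Geometry

theorem LatticeAdj.symm {a b : ℤ × ℤ} (h : LatticeAdj a b) : LatticeAdj b a := by
  simp only [LatticeAdj, Prod.ext_iff, Prod.fst_sub, Prod.snd_sub] at h ⊢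
  lia

theorem LatticeAdj.abs_sub_le {a b : ℤ × ℤ} (h : LatticeAdj a b) :
    |a.1 - b.1| ≤ 1 ∧ |a.2 - b.2| ≤ 1 := by
  simp only [LatticeAdj, Prod.ext_iff, Prod.fst_sub, Prod.snd_sub] at h
  simp only [abs_le]
  lia

/-- `sideOf` for integral points. -/
def latticeSide (l r x : ℤ × ℤ) : ℤ := (l.1 - r.1) * (x.2 - r.2) - (l.2 - r.2) * (x.1 - r.1)

/-- The height of `a` over the line directed from `(0, 0)` to `(p, q)`, in units of
`1 / √(p² + q²)`; positive to the left of the line. -/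
def height (p q : ℤ) (a : ℤ × ℤ) : ℤ := p * a.2 - q * a.1

theorem sideOf_latticePoint (l r x : ℤ × ℤ) :
    sideOf l r (latticePoint x) = (latticeSide l r x : ℝ) := by
  simp [sideOf, latticePoint, latticeSide]

theorem sideOf_zero_latticePoint (p q : ℤ) (a : ℤ × ℤ) :
    sideOf (p, q) (0, 0) (latticePoint a) = (height p q a : ℝ) := by
  simp [sideOf, latticePoint, height]

theorem latticeSide_left (l r : ℤ × ℤ) : latticeSide l r l = 0 := by
  rw [latticeSide]; ring

theorem latticeSide_right (l r : ℤ × ℤ) : latticeSide l r r = 0 := by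
  rw [latticeSide]; ring

theorem sideOf_swap (l r : ℤ × ℤ) (x : ℝ × ℝ) : sideOf r l x = -sideOf l r x := by
  simp only [sideOf]; ring

theorem sideOf_convexComb (l r : ℤ × ℤ) (x y : ℝ × ℝ) {a b : ℝ} (hab : a + b = 1) :
    sideOf l r (a • x + b • y) = a * sideOf l r x + b * sideOf l r y := by
  obtain rfl : b = 1 - a := by linarith
  simp only [sideOf, Prod.fst_add, Prod.snd_add, Prod.smul_fst, Prod.smul_snd, smul_eq_mul]
  ring

theorem mem_openSegment_of_sideOf_eq_zero {p q : ℤ} {l r : ℤ × ℤ} {x : ℝ × ℝ}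
    (hx : sideOf l r x = 0) (hr : height p q r < sideOf (p, q) (0, 0) x)
    (hl : sideOf (p, q) (0, 0) x < height p q l) :
    x ∈ openSegment ℝ (latticePoint l) (latticePoint r) := by
  set h := sideOf (p, q) (0, 0) x with hdef
  have width_pos : (0 : ℝ) < height p q l - height p q r := by linarith
  refine ⟨(h - height p q r) / (height p q l - height p q r),
    (height p q l - h) / (height p q l - height p q r), div_pos (by linarith) width_pos,
    div_pos (by linarith) width_pos, ?_, ?_⟩
  · field_simp
    ring
  · simp only [sideOf, Int.cast_zero] at hx hdef
    simp only [height, Int.cast_sub, Int.cast_mul] at width_pos ⊢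
    ext
    · simp only [latticePoint, Prod.smul_mk, smul_eq_mul, Prod.mk_add_mk]
      field_simp
      rw [hdef]
      linear_combination (p : ℝ) * hx
    · simp only [latticePoint, Prod.smul_mk, smul_eq_mul, Prod.mk_add_mk]
      field_simp
      rw [hdef]
      linear_combination (q : ℝ) * hx

theorem dist_convexComb_lt_iff {E : Type*} [NormedAddCommGroup E] [NormedSpace ℝ E] {x y : E}
    (hxy : x ≠ y) {a b : ℝ} (ha : 0 ≤ a) (hb : 0 ≤ b) (hab : a + b = 1) :
    dist (a • x + b • y) y < dist (a • x + b • y) x ↔ a < b := by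
  obtain rfl : b = 1 - a := by linarith
  have sub_right : a • x + (1 - a) • y - y = a • (x - y) := by module
  have sub_left : a • x + (1 - a) • y - x = -((1 - a) • (x - y)) := by module
  rw [dist_eq_norm, dist_eq_norm, sub_right, sub_left, norm_neg, norm_smul, norm_smul,
    Real.norm_of_nonneg ha, Real.norm_of_nonneg hb,
    mul_lt_mul_iff_left₀ (norm_pos_iff.2 (sub_ne_zero.2 hxy))]

variable {p q : ℤ}

theorem leftCurve_zero : leftCurve p q 0 = latticePoint (0, 0) := by simp [leftCurve, latticePoint]

theorem leftCurve_one : leftCurve p q 1 = latticePoint (p, q) := by simp [leftCurve, latticePoint]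

theorem sideOf_zero_leftCurve (hpq : (p, q) ≠ (0, 0)) (t : ℝ) :
    sideOf (p, q) (0, 0) (leftCurve p q t) = t * (1 - t) / 4 := by
  have : (p : ℝ) ^ 2 + (q : ℝ) ^ 2 ≠ 0 := by
    contrapose! hpq
    have : p ^ 2 + q ^ 2 = 0 := by exact_mod_cast hpq
    have : p = 0 := by nlinarith
    have : q = 0 := by nlinarith
    simp [*]
  simp only [sideOf, leftCurve, Int.cast_zero]
  field_simp
  ring

theorem sideOf_zero_leftCurve_mem_Ioo (hpq : (p, q) ≠ (0, 0)) {t : ℝ} (ht : t ∈ Set.Ioo 0 1) :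
    sideOf (p, q) (0, 0) (leftCurve p q t) ∈ Set.Ioo 0 (1 / 4) := by
  rw [sideOf_zero_leftCurve hpq]
  constructor <;> nlinarith [ht.1, ht.2]

theorem sideOf_leftCurve_sub (l r : ℤ × ℤ) (s t : ℝ) :
    sideOf l r (leftCurve p q s) - sideOf l r (leftCurve p q t) =
      (t - s) * ((height p q l - height p q r : ℤ) - (1 - t - s) *
        (((l.1 - r.1) * p + (l.2 - r.2) * q) / (4 * ((p : ℝ) ^ 2 + (q : ℝ) ^ 2)))) := by
  simp only [sideOf, leftCurve, height]
  push_cast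
  ring

theorem LatticeAdj.abs_inner_le {l r : ℤ × ℤ} (h : LatticeAdj l r) :
    |(l.1 - r.1) * p + (l.2 - r.2) * q| ≤ p ^ 2 + q ^ 2 := by
  have abs_mul_le {u z : ℤ} (hu : |u| ≤ 1) : |u * z| ≤ z ^ 2 := by
    rw [abs_mul]
    nlinarith [Int.le_self_sq |z|, sq_abs z, abs_nonneg z]
  exact (abs_add_le _ _).trans
    (add_le_add (abs_mul_le h.abs_sub_le.1) (abs_mul_le h.abs_sub_le.2))

theorem LatticeAdj.strictAntiOn_sideOf_leftCurve {l r : ℤ × ℤ} (hlr : LatticeAdj l r)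
    (h : height p q r < height p q l) :
    StrictAntiOn (fun t => sideOf l r (leftCurve p q t)) (Set.Icc 0 1) := by
  intro s hs t ht hst
  rw [← sub_pos, sideOf_leftCurve_sub]
  refine mul_pos (by linarith) ?_
  have one_le : (1 : ℝ) ≤ (height p q l - height p q r : ℤ) := by
    exact_mod_cast (by lia : (1 : ℤ) ≤ height p q l - height p q r)
  have abs_quotient_le : |(((l.1 : ℝ) - r.1) * p + ((l.2 : ℝ) - r.2) * q) /
      (4 * ((p : ℝ) ^ 2 + (q : ℝ) ^ 2))| ≤ 1 / 4 := by
    rw [abs_div, abs_of_nonneg (by positivity : (0 : ℝ) ≤ 4 * ((p : ℝ) ^ 2 + (q : ℝ) ^ 2))]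
    refine div_le_of_le_mul₀ (by positivity) (by norm_num) ?_
    have : |((l.1 : ℝ) - r.1) * p + ((l.2 : ℝ) - r.2) * q| ≤ (p : ℝ) ^ 2 + (q : ℝ) ^ 2 := by
      exact_mod_cast hlr.abs_inner_le
    linarith
  have abs_factor_le : |1 - t - s| ≤ 1 := abs_le.2 ⟨by linarith [hs.2, ht.2],
    by linarith [hs.1, ht.1]⟩
  have := mul_le_mul abs_factor_le abs_quotient_le (abs_nonneg _) zero_le_one
  rw [← abs_mul] at this
  linarith [(abs_le.1 this).2]

/-- The combinatorial description of the segments of `𝓛` that `γ^L_{(p,q)}` crosses, with the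
endpoint `l` to its left and `r` to its right. -/
structure IsCrossed (p q : ℤ) (l r : ℤ × ℤ) : Prop where
  adj : LatticeAdj l r
  height_left : 0 < height p q l
  height_right : height p q r ≤ 0
  side_start : 0 < latticeSide l r (0, 0)
  side_end : latticeSide l r (p, q) < 0

namespace IsCrossed

variable {l r : ℤ × ℤ}

theorem strictAntiOn (h : IsCrossed p q l r) :
    StrictAntiOn (fun t => sideOf l r (leftCurve p q t)) (Set.Icc 0 1) :=
  h.adj.strictAntiOn_sideOf_leftCurve (h.height_right.trans_lt h.height_left)

theorem exists_crossing (hpq : (p, q) ≠ (0, 0)) (h : IsCrossed p q l r) :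
    ∃ c : Crossing (leftCurve p q), c.left = l ∧ c.right = r := by
  have continuous_side : Continuous fun t => sideOf l r (leftCurve p q t) := by
    unfold sideOf leftCurve
    fun_prop
  have start_pos : 0 < sideOf l r (leftCurve p q 0) := by
    rw [leftCurve_zero, sideOf_latticePoint]; exact_mod_cast h.side_start
  have end_neg : sideOf l r (leftCurve p q 1) < 0 := by
    rw [leftCurve_one, sideOf_latticePoint]; exact_mod_cast h.side_end
  obtain ⟨t, ht, side_eq⟩ :=
    intermediate_value_Ioo' zero_le_one continuous_side.continuousOn ⟨end_neg, start_pos⟩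
  have t_mem := Set.Ioo_subset_Icc_self ht
  refine ⟨⟨t, l, r, ht, h.adj, ?_, ?_, ?_⟩, rfl, rfl⟩
  · have height_mem := sideOf_zero_leftCurve_mem_Ioo hpq ht
    have left_ge : (1 : ℝ) ≤ height p q l := by exact_mod_cast h.height_left
    have right_le : (height p q r : ℝ) ≤ 0 := by exact_mod_cast h.height_right
    exact mem_openSegment_of_sideOf_eq_zero side_eq (by linarith [height_mem.1])
      (by linarith [height_mem.2])
  · filter_upwards [Ioo_mem_nhdsLT ht.1] with s hs
    exact side_eq.symm.trans_lt (h.strictAntiOn ⟨hs.1.le, hs.2.le.trans ht.2.le⟩ t_mem hs.2)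
  · filter_upwards [Ioo_mem_nhdsGT ht.2] with s hs
    exact (h.strictAntiOn t_mem ⟨ht.1.le.trans hs.1.le, hs.2.le⟩ hs.1).trans_eq side_eq

end IsCrossed

namespace Crossing

theorem sideOf_time {γ : ℝ → ℝ × ℝ} (c : Crossing γ) : sideOf c.left c.right (γ c.time) = 0 := by
  obtain ⟨a, b, -, -, hab, heq⟩ := c.mem_segment
  rw [← heq, sideOf_convexComb _ _ _ _ hab, sideOf_latticePoint, sideOf_latticePoint,
    latticeSide_left, latticeSide_right]
  simp

theorem exists_height_eq (c : Crossing (leftCurve p q)) : ∃ a b : ℝ, 0 < a ∧ 0 < b ∧ a + b = 1 ∧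
    leftCurve p q c.time = a • latticePoint c.left + b • latticePoint c.right ∧
    sideOf (p, q) (0, 0) (leftCurve p q c.time) =
      a * height p q c.left + b * height p q c.right := by
  obtain ⟨a, b, ha, hb, hab, heq⟩ := c.mem_segment
  refine ⟨a, b, ha, hb, hab, heq.symm, ?_⟩
  rw [← heq, sideOf_convexComb _ _ _ _ hab, sideOf_zero_latticePoint, sideOf_zero_latticePoint]

theorem time_mem_Icc {γ : ℝ → ℝ × ℝ} (c : Crossing γ) : c.time ∈ Set.Icc (0 : ℝ) 1 :=
  Set.Ioo_subset_Icc_self c.time_mem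

theorem height_right_lt_height_left (hpq : (p, q) ≠ (0, 0)) (c : Crossing (leftCurve p q)) :
    height p q c.right < height p q c.left := by
  obtain ⟨a, b, ha, hb, hab, -, height_eq⟩ := c.exists_height_eq
  have height_mem := sideOf_zero_leftCurve_mem_Ioo hpq c.time_mem
  rw [height_eq] at height_mem
  by_contra hle
  rcases (not_lt.1 hle).eq_or_lt with heq | hlt
  · rw [heq, ← add_mul, hab, one_mul] at height_mem
    have pos : (0 : ℝ) < (height p q c.right : ℝ) := height_mem.1
    have lt_one : (height p q c.right : ℝ) < 1 := by linarith [height_mem.2]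
    norm_cast at pos lt_one
    lia
  · obtain ⟨s, side_pos, hs⟩ := (c.before.and (Ioo_mem_nhdsLT c.time_mem.1)).exists
    have := c.adj.symm.strictAntiOn_sideOf_leftCurve hlt ⟨hs.1.le, hs.2.le.trans c.time_mem.2.le⟩
      c.time_mem_Icc hs.2
    simp only [sideOf_swap c.left, c.sideOf_time] at this
    linarith

theorem isCrossed (hpq : (p, q) ≠ (0, 0)) (c : Crossing (leftCurve p q)) :
    IsCrossed p q c.left c.right := by
  have height_lt := c.height_right_lt_height_left hpq
  have anti := c.adj.strictAntiOn_sideOf_leftCurve height_lt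
  obtain ⟨a, b, ha, hb, hab, -, height_eq⟩ := c.exists_height_eq
  have height_mem := sideOf_zero_leftCurve_mem_Ioo hpq c.time_mem
  rw [height_eq] at height_mem
  have height_lt' : (height p q c.right : ℝ) < height p q c.left := by exact_mod_cast height_lt
  refine ⟨c.adj, ?_, ?_, ?_, ?_⟩
  · have : (0 : ℝ) < height p q c.left := by nlinarith [height_mem.1]
    exact_mod_cast this
  · have : (height p q c.right : ℝ) < 1 := by nlinarith [height_mem.2]
    exact Int.lt_add_one_iff.1 (by exact_mod_cast this)
  · have := anti (Set.left_mem_Icc.2 zero_le_one) c.time_mem_Icc c.time_mem.1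
    simp only [c.sideOf_time, leftCurve_zero, sideOf_latticePoint] at this
    exact_mod_cast this
  · have := anti c.time_mem_Icc (Set.right_mem_Icc.2 zero_le_one) c.time_mem.2
    simp only [c.sideOf_time, leftCurve_one, sideOf_latticePoint] at this
    exact_mod_cast this

theorem sideOf_pos_iff (hpq : (p, q) ≠ (0, 0)) (c : Crossing (leftCurve p q)) {t : ℝ}
    (ht : t ∈ Set.Icc 0 1) : 0 < sideOf c.left c.right (leftCurve p q t) ↔ t < c.time := by
  rw [← c.sideOf_time]
  exact (c.isCrossed hpq).strictAntiOn.lt_iff_gt c.time_mem_Icc ht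

theorem eq_of_endpoints (hpq : (p, q) ≠ (0, 0)) {c c' : Crossing (leftCurve p q)}
    (hl : c.left = c'.left) (hr : c.right = c'.right) : c = c' := by
  have time_eq : c.time = c'.time := by
    refine (c.isCrossed hpq).strictAntiOn.injOn c.time_mem_Icc c'.time_mem_Icc
      (c.sideOf_time.trans ?_)
    rw [hl, hr, c'.sideOf_time]
  cases c
  cases c'
  congr

theorem time_lt_of_right_eq (hpq : (p, q) ≠ (0, 0)) {c c' : Crossing (leftCurve p q)}
    (hr : c.right = c'.right) (h : 0 < latticeSide c'.left c'.right c.left) :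
    c.time < c'.time := by
  obtain ⟨a, b, ha, -, hab, curve_eq, -⟩ := c.exists_height_eq
  rw [← c'.sideOf_pos_iff hpq c.time_mem_Icc, curve_eq, sideOf_convexComb _ _ _ _ hab, hr,
    sideOf_latticePoint, sideOf_latticePoint, latticeSide_right, Int.cast_zero, mul_zero, add_zero]
  exact mul_pos ha (by exact_mod_cast h)

theorem time_lt_of_left_eq (hpq : (p, q) ≠ (0, 0)) {c c' : Crossing (leftCurve p q)}
    (hl : c.left = c'.left) (h : 0 < latticeSide c'.left c'.right c.right) :
    c.time < c'.time := by
  obtain ⟨a, b, -, hb, hab, curve_eq, -⟩ := c.exists_height_eq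
  rw [← c'.sideOf_pos_iff hpq c.time_mem_Icc, curve_eq, sideOf_convexComb _ _ _ _ hab, hl,
    sideOf_latticePoint, sideOf_latticePoint, latticeSide_left, Int.cast_zero, mul_zero, zero_add]
  exact mul_pos hb (by exact_mod_cast h)

theorem closerToRight_iff (hpq : (p, q) ≠ (0, 0)) (c : Crossing (leftCurve p q)) :
    c.CloserToRight ↔ 0 < height p q c.left + height p q c.right := by
  obtain ⟨a, b, ha, hb, hab, curve_eq, height_eq⟩ := c.exists_height_eq
  obtain ⟨height_pos, height_lt⟩ := sideOf_zero_leftCurve_mem_Ioo hpq c.time_mem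
  have left_ge : (1 : ℝ) ≤ height p q c.left := by exact_mod_cast (c.isCrossed hpq).height_left
  have endpoints_ne : latticePoint c.left ≠ latticePoint c.right := by
    intro heq
    have heights := congrArg (sideOf (p, q) (0, 0)) heq
    rw [sideOf_zero_latticePoint, sideOf_zero_latticePoint] at heights
    exact (c.height_right_lt_height_left hpq).ne' (by exact_mod_cast heights)
  rw [CloserToRight, curve_eq, dist_convexComb_lt_iff endpoints_ne ha.le hb.le hab]
  constructor
  · intro hlt
    have : (0 : ℝ) < height p q c.left + height p q c.right := by nlinarith
    exact_mod_cast this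
  · intro h
    have : (1 : ℝ) ≤ height p q c.left + height p q c.right := by exact_mod_cast h
    nlinarith

end Crossing

/-- `l i`–`r i`, for `i ≤ N`, are all crossed segments in their order along `γ^L_{(p,q)}`, `d i`
tells whether the `i`-th one is crossed closer to its right endpoint, and `s i` whether it shares
its right or its left endpoint with the next one. -/
structure SegmentSequence (p q : ℤ) (N : ℕ) (l r : ℕ → ℤ × ℤ) (d s : ℕ → Bool) : Prop where
  crossed : ∀ i ≤ N, IsCrossed p q (l i) (r i)
  exhaustive : ∀ a b, IsCrossed p q a b → ∃ i ≤ N, l i = a ∧ r i = b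
  closer : ∀ i ≤ N, 0 < height p q (l i) + height p q (r i) ↔ d i = true
  link_right : ∀ i < N, s i = true →
    r i = r (i + 1) ∧ 0 < latticeSide (l (i + 1)) (r (i + 1)) (l i)
  link_left : ∀ i < N, s i = false →
    l i = l (i + 1) ∧ 0 < latticeSide (l (i + 1)) (r (i + 1)) (r i)

namespace SegmentSequence

variable {N : ℕ} {l r : ℕ → ℤ × ℤ} {d s : ℕ → Bool}

theorem right_eq_iff (h : SegmentSequence p q N l r d s) {i : ℕ} (hi : i < N) :
    r i = r (i + 1) ↔ s i = true := by
  refine ⟨fun heq => ?_, fun hs => (h.link_right i hi hs).1⟩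
  by_contra hs
  have := (h.link_left i hi (by simpa using hs)).2
  rw [heq, latticeSide_right] at this
  exact this.false

theorem left_eq_iff (h : SegmentSequence p q N l r d s) {i : ℕ} (hi : i < N) :
    l i = l (i + 1) ↔ s i = false := by
  refine ⟨fun heq => ?_, fun hs => (h.link_left i hi hs).1⟩
  by_contra hs
  have := (h.link_right i hi (by simpa using hs)).2
  rw [heq, latticeSide_left] at this
  exact this.false

theorem exists_crossingSequence (h : SegmentSequence p q N l r d s) (hpq : (p, q) ≠ (0, 0)) :
    ∃ c : ℕ → Crossing (leftCurve p q), CrossingSequence N c d s := by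
  have : Nonempty (Crossing (leftCurve p q)) :=
    ((h.crossed 0 N.zero_le).exists_crossing hpq).nonempty
  choose! c left_eq right_eq using fun i (hi : i ≤ N) => (h.crossed i hi).exists_crossing hpq
  refine ⟨c, ⟨fun i hi => ?_, fun x => ?_, fun i hi => ?_, fun i hi => ?_, fun i hi => ?_⟩⟩
  · cases hs : s i with
    | true =>
      obtain ⟨shared, before⟩ := h.link_right i hi hs
      refine Crossing.time_lt_of_right_eq hpq ?_ ?_
      · rw [right_eq i hi.le, right_eq (i + 1) hi, shared]
      · rwa [right_eq (i + 1) hi, left_eq (i + 1) hi, left_eq i hi.le]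
    | false =>
      obtain ⟨shared, before⟩ := h.link_left i hi hs
      refine Crossing.time_lt_of_left_eq hpq ?_ ?_
      · rw [left_eq i hi.le, left_eq (i + 1) hi, shared]
      · rwa [right_eq (i + 1) hi, left_eq (i + 1) hi, right_eq i hi.le]
  · obtain ⟨i, hi, hl, hr⟩ := h.exhaustive x.left x.right (x.isCrossed hpq)
    exact ⟨i, hi, Crossing.eq_of_endpoints hpq ((left_eq i hi).trans hl)
      ((right_eq i hi).trans hr)⟩
  · rw [Crossing.closerToRight_iff hpq, left_eq i hi, right_eq i hi, h.closer i hi]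
  · rw [right_eq i hi.le, right_eq (i + 1) hi, h.right_eq_iff hi]
  · rw [left_eq i hi.le, left_eq (i + 1) hi, h.left_eq_iff hi]

theorem kMarkov_eq (h : SegmentSequence p q N l r d s) (hpq : (p, q) ≠ (0, 0)) (k : ℕ) :
    kMarkov k p q = chainFenceCard k d s N :=
  let ⟨_, hc⟩ := h.exists_crossingSequence hpq
  hc.card_lowerSet k

end SegmentSequence

theorem kMarkov_eq_one (k : ℕ) (hpq : (p, q) ≠ (0, 0)) (h : ∀ l r, ¬ IsCrossed p q l r) :
    kMarkov k p q = 1 := by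
  have : IsEmpty (CurvePoset k (leftCurve p q)) := ⟨fun x => h _ _ (x.1.isCrossed hpq)⟩
  exact Nat.card_eq_one_iff_unique.2 ⟨⟨fun S S' => LowerSet.ext (Subsingleton.elim _ _)⟩, ⟨⊥⟩⟩

end Geometry

section Staircase

theorem IsCrossed.left_eq {p q : ℤ} (hp : 0 ≤ p) (hq : 0 ≤ q) {l r : ℤ × ℤ}
    (h : IsCrossed p q l r) :
    l = (r.1 - 1, r.2 + 1) ∨ l = (r.1, r.2 + 1) ∨ l = (r.1 - 1, r.2) := by
  have height_lt := h.height_right.trans_lt h.height_left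
  have adj := h.adj
  simp only [LatticeAdj, Prod.ext_iff, Prod.fst_sub, Prod.snd_sub] at adj
  simp only [height, Prod.ext_iff] at height_lt ⊢
  rcases adj with h | h | h | h | h | h <;> first | lia | nlinarith

theorem isCrossed_diagonal_iff {p q x y : ℤ} : IsCrossed p q (x - 1, y + 1) (x, y) ↔
    (0 < x + y ∧ x + y < p + q) ∧ p * y ≤ q * x ∧ q * (x - 1) < p * (y + 1) := by
  constructor
  · rintro ⟨-, hl, hr, h0, h1⟩
    simp only [height, latticeSide] at hl hr h0 h1
    grind
  · rintro ⟨⟨h0, h1⟩, hr, hl⟩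
    exact ⟨by simp [LatticeAdj], by simp only [height]; lia, by simp only [height]; lia,
      by simp only [latticeSide]; lia, by simp only [latticeSide]; lia⟩

theorem isCrossed_vertical_iff {p q x y : ℤ} : IsCrossed p q (x, y + 1) (x, y) ↔
    (0 < x ∧ x < p) ∧ p * y ≤ q * x ∧ q * x < p * (y + 1) := by
  constructor
  · rintro ⟨-, hl, hr, h0, h1⟩
    simp only [height, latticeSide] at hl hr h0 h1
    grind
  · rintro ⟨⟨h0, h1⟩, hr, hl⟩
    exact ⟨by simp [LatticeAdj], by simp only [height]; lia, by simp only [height]; lia,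
      by simp only [latticeSide]; lia, by simp only [latticeSide]; lia⟩

theorem isCrossed_horizontal_iff {p q x y : ℤ} : IsCrossed p q (x - 1, y) (x, y) ↔
    (0 < y ∧ y < q) ∧ p * y ≤ q * x ∧ q * (x - 1) < p * y := by
  constructor
  · rintro ⟨-, hl, hr, h0, h1⟩
    simp only [height, latticeSide] at hl hr h0 h1
    grind
  · rintro ⟨⟨h0, h1⟩, hr, hl⟩
    exact ⟨by simp [LatticeAdj], by simp only [height]; lia, by simp only [height]; lia,
      by simp only [latticeSide]; lia, by simp only [latticeSide]; lia⟩

/-- The ordinate of the integral point on the line `x + y = s` that lies next to `γ^L_{(p,q)}` on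
its right. -/
def rise (p q s : ℕ) : ℕ := q * s / (p + q)

/-- The left endpoint of the `i`-th segment that `γ^L_{(p,q)}` crosses. -/
def stairLeft (p q i : ℕ) : ℤ × ℤ :=
  ((((i + 1) / 2 : ℕ) : ℤ) - rise p q ((i + 1) / 2 + 1), rise p q (i / 2 + 1) + 1)

/-- The right endpoint of the `i`-th segment that `γ^L_{(p,q)}` crosses. -/
def stairRight (p q i : ℕ) : ℤ × ℤ :=
  (((i / 2 : ℕ) : ℤ) + 1 - rise p q (i / 2 + 1), rise p q ((i + 1) / 2 + 1))

/-- Whether the `i`-th segment is crossed closer to its right endpoint. -/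
def stairCloser (p q i : ℕ) : Bool :=
  q * (i + 2) < (p + q) * (rise p q (i / 2 + 1) + rise p q ((i + 1) / 2 + 1) + 1)

/-- Whether the `i`-th and the `(i + 1)`-th segment share their right endpoint. -/
def stairLink (p q i : ℕ) : Bool :=
  i % 2 = 0 ↔ rise p q (i / 2 + 1) = rise p q (i / 2 + 2)

variable {p q : ℕ}

theorem rise_eq_iff (hp : 0 < p) {s y : ℕ} :
    rise p q s = y ↔ (p + q) * y ≤ q * s ∧ q * s < (p + q) * (y + 1) := by
  rw [rise, Nat.div_eq_iff (by lia)]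
  grind

theorem rise_spec (hp : 0 < p) (s : ℕ) :
    (p + q) * rise p q s ≤ q * s ∧ q * s < (p + q) * (rise p q s + 1) :=
  (rise_eq_iff hp).1 rfl

theorem rise_succ (hp : 0 < p) (s : ℕ) :
    rise p q (s + 1) = rise p q s ∨ rise p q (s + 1) = rise p q s + 1 := by
  obtain ⟨le, lt⟩ := rise_spec (q := q) hp s
  rw [rise_eq_iff hp, rise_eq_iff hp]
  grind

theorem stairLeft_even (m : ℕ) :
    stairLeft p q (2 * m) = ((m : ℤ) - rise p q (m + 1), (rise p q (m + 1) : ℤ) + 1) := by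
  rw [stairLeft, show (2 * m + 1) / 2 = m by lia, show 2 * m / 2 = m by lia]

theorem stairRight_even (m : ℕ) :
    stairRight p q (2 * m) = ((m : ℤ) + 1 - rise p q (m + 1), (rise p q (m + 1) : ℤ)) := by
  rw [stairRight, show (2 * m + 1) / 2 = m by lia, show 2 * m / 2 = m by lia]

theorem stairLeft_odd (m : ℕ) :
    stairLeft p q (2 * m + 1) = ((m : ℤ) + 1 - rise p q (m + 2), (rise p q (m + 1) : ℤ) + 1) := by
  rw [stairLeft, show (2 * m + 1 + 1) / 2 = m + 1 by lia, show (2 * m + 1) / 2 = m by lia]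
  push_cast
  rfl

theorem stairRight_odd (m : ℕ) :
    stairRight p q (2 * m + 1) = ((m : ℤ) + 1 - rise p q (m + 1), (rise p q (m + 2) : ℤ)) := by
  rw [stairRight, show (2 * m + 1 + 1) / 2 = m + 1 by lia, show (2 * m + 1) / 2 = m by lia]

theorem isCrossed_stair_even (hp : 0 < p) {m : ℕ} (hm : m + 2 ≤ p + q) :
    IsCrossed p q (stairLeft p q (2 * m)) (stairRight p q (2 * m)) := by
  obtain ⟨le, lt⟩ := rise_spec (q := q) hp (m + 1)
  rw [stairLeft_even, stairRight_even]
  generalize rise p q (m + 1) = y at *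
  zify at le lt hm
  have := isCrossed_diagonal_iff (p := p) (q := q) (x := m + 1 - y) (y := y)
  rw [show (m : ℤ) + 1 - y - 1 = m - y by ring] at this
  exact this.2 ⟨by lia, by linarith, by linarith⟩

theorem isCrossed_stair_odd (hp : 0 < p) {m : ℕ}
    (hm : m + 2 < p + q ∨ q = 0 ∧ m + 2 ≤ p) :
    IsCrossed p q (stairLeft p q (2 * m + 1)) (stairRight p q (2 * m + 1)) := by
  obtain ⟨le, lt⟩ := rise_spec (q := q) hp (m + 1)
  obtain ⟨le', lt'⟩ := rise_spec (q := q) hp (m + 2)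
  rw [stairLeft_odd, stairRight_odd]
  rcases rise_succ (q := q) hp (m + 1) with eq | eq <;> rw [eq] at le' lt' ⊢ <;>
    generalize rise p q (m + 1) = y at * <;> zify at *
  · refine isCrossed_vertical_iff.2 ⟨⟨by nlinarith, ?_⟩, by linarith, by linarith⟩
    by_contra! le_x
    have q_lt : (q : ℤ) < y + 1 := by nlinarith
    lia
  · have := isCrossed_horizontal_iff (p := p) (q := q) (x := m + 1 - y) (y := y + 1)
    rw [show (m : ℤ) + 1 - y - 1 = m + 1 - (y + 1) by ring] at this
    have q_pos : (0 : ℤ) < q := by nlinarith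
    have m_lt : (m : ℤ) + 2 < p + q := by lia
    exact this.2 ⟨⟨by lia, by nlinarith⟩, by linarith, by linarith⟩

theorem exists_stair_even_of_isCrossed (hp : 0 < p) {x y : ℤ}
    (h : IsCrossed p q (x - 1, y + 1) (x, y)) :
    ∃ m, m + 2 ≤ p + q ∧ stairLeft p q (2 * m) = (x - 1, y + 1) ∧
      stairRight p q (2 * m) = (x, y) := by
  obtain ⟨⟨h0, h1⟩, le, lt⟩ := isCrossed_diagonal_iff.1 h
  have y_nonneg : 0 ≤ y := by nlinarith
  lift y to ℕ using y_nonneg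
  obtain ⟨m, hm⟩ := Int.eq_ofNat_of_zero_le (show 0 ≤ x + y - 1 by lia)
  obtain rfl : x = m + 1 - y := by lia
  have rise_eq : rise p q (m + 1) = y := (rise_eq_iff hp).2 ⟨by zify; linarith, by zify; linarith⟩
  refine ⟨m, by lia, ?_, ?_⟩
  · rw [stairLeft_even, rise_eq]; ring_nf
  · rw [stairRight_even, rise_eq]

theorem exists_stair_odd_of_isCrossed_vertical (hp : 0 < p) {x y : ℤ}
    (h : IsCrossed p q (x, y + 1) (x, y)) :
    ∃ m, (m + 2 < p + q ∨ q = 0 ∧ m + 2 ≤ p) ∧ stairLeft p q (2 * m + 1) = (x, y + 1) ∧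
      stairRight p q (2 * m + 1) = (x, y) := by
  obtain ⟨⟨h0, h1⟩, le, lt⟩ := isCrossed_vertical_iff.1 h
  have y_nonneg : 0 ≤ y := by nlinarith
  lift y to ℕ using y_nonneg
  obtain ⟨m, hm⟩ := Int.eq_ofNat_of_zero_le (show 0 ≤ x + y - 1 by lia)
  obtain rfl : x = m + 1 - y := by lia
  have rise_eq : rise p q (m + 1) = y := (rise_eq_iff hp).2 ⟨by zify; linarith, by zify; nlinarith⟩
  have rise_eq' : rise p q (m + 2) = y := (rise_eq_iff hp).2 ⟨by zify; nlinarith, by zify; linarith⟩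
  refine ⟨m, ?_, ?_, ?_⟩
  · rcases q.eq_zero_or_pos with rfl | hq
    · obtain rfl : 0 = y := by simpa [rise] using rise_eq
      lia
    · have : (y : ℤ) < q := by nlinarith
      lia
  · rw [stairLeft_odd, rise_eq, rise_eq']
  · rw [stairRight_odd, rise_eq, rise_eq']

theorem exists_stair_odd_of_isCrossed_horizontal (hp : 0 < p) {x y : ℤ}
    (h : IsCrossed p q (x - 1, y) (x, y)) :
    ∃ m, m + 2 < p + q ∧ stairLeft p q (2 * m + 1) = (x - 1, y) ∧
      stairRight p q (2 * m + 1) = (x, y) := by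
  obtain ⟨⟨h0, h1⟩, le, lt⟩ := isCrossed_horizontal_iff.1 h
  have x_pos : 0 < x := by nlinarith
  have x_le : x ≤ p := by by_contra!; nlinarith
  obtain ⟨z, rfl⟩ : ∃ z : ℕ, y = z + 1 := ⟨(y - 1).toNat, by lia⟩
  obtain ⟨m, hm⟩ := Int.eq_ofNat_of_zero_le (show 0 ≤ x + z - 1 by lia)
  obtain rfl : x = m + 1 - z := by lia
  have rise_eq : rise p q (m + 1) = z := (rise_eq_iff hp).2 ⟨by zify; nlinarith, by zify; linarith⟩
  have rise_eq' : rise p q (m + 2) = z + 1 :=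
    (rise_eq_iff hp).2 ⟨by zify; linarith, by zify; nlinarith⟩
  refine ⟨m, by lia, ?_, ?_⟩
  · rw [stairLeft_odd, rise_eq, rise_eq']; push_cast; ring_nf
  · rw [stairRight_odd, rise_eq, rise_eq']; push_cast; rfl

theorem height_stair_add (i : ℕ) :
    height p q (stairLeft p q i) + height p q (stairRight p q i) =
      (p + q) * (rise p q (i / 2 + 1) + rise p q ((i + 1) / 2 + 1) + 1) - q * (i + 2) := by
  have : (i : ℤ) = (i / 2 : ℕ) + ((i + 1) / 2 : ℕ) := by lia
  rw [this]
  simp only [height, stairLeft, stairRight]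
  ring

theorem stair_link_right (hp : 0 < p) {i : ℕ} (h : stairLink p q i = true) :
    stairRight p q i = stairRight p q (i + 1) ∧
      0 < latticeSide (stairLeft p q (i + 1)) (stairRight p q (i + 1)) (stairLeft p q i) := by
  rw [stairLink, decide_eq_true_iff] at h
  obtain ⟨m, rfl | rfl⟩ := i.even_or_odd'
  · rw [show 2 * m / 2 = m by lia] at h
    have rise_eq : rise p q (m + 2) = rise p q (m + 1) := by lia
    rw [stairRight_even, stairRight_odd, stairLeft_even, stairLeft_odd, rise_eq]
    simp [latticeSide]
  · rw [show (2 * m + 1) / 2 = m by lia] at h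
    have rise_eq : rise p q (m + 2) = rise p q (m + 1) + 1 :=
      (rise_succ hp (m + 1)).resolve_left (by lia)
    rw [show 2 * m + 1 + 1 = 2 * (m + 1) by ring, stairRight_even, stairRight_odd, stairLeft_even,
      stairLeft_odd, rise_eq]
    simp [latticeSide]

theorem stair_link_left (hp : 0 < p) {i : ℕ} (h : stairLink p q i = false) :
    stairLeft p q i = stairLeft p q (i + 1) ∧
      0 < latticeSide (stairLeft p q (i + 1)) (stairRight p q (i + 1)) (stairRight p q i) := by
  rw [stairLink, decide_eq_false_iff_not] at h
  obtain ⟨m, rfl | rfl⟩ := i.even_or_odd'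
  · rw [show 2 * m / 2 = m by lia] at h
    have rise_eq : rise p q (m + 2) = rise p q (m + 1) + 1 :=
      (rise_succ hp (m + 1)).resolve_left (by lia)
    rw [stairRight_even, stairRight_odd, stairLeft_even, stairLeft_odd, rise_eq]
    simp [latticeSide]
  · rw [show (2 * m + 1) / 2 = m by lia] at h
    have rise_eq : rise p q (m + 2) = rise p q (m + 1) := by lia
    rw [show 2 * m + 1 + 1 = 2 * (m + 1) by ring, stairRight_even, stairRight_odd, stairLeft_even,
      stairLeft_odd, rise_eq]
    simp [latticeSide]

theorem segmentSequence_stair (hp : 0 < p) {N : ℕ}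
    (hN : N + 4 = 2 * (p + q) + if q = 0 then 1 else 0) :
    SegmentSequence p q N (stairLeft p q) (stairRight p q) (stairCloser p q) (stairLink p q) where
  crossed i hi := by
    obtain ⟨m, rfl | rfl⟩ := i.even_or_odd'
    · exact isCrossed_stair_even hp (by lia)
    · exact isCrossed_stair_odd hp (by lia)
  exhaustive l r h := by
    obtain ⟨x, y⟩ := r
    rcases h.left_eq (by lia) (by lia) with rfl | rfl | rfl
    · obtain ⟨m, hm, hlr⟩ := exists_stair_even_of_isCrossed hp h
      exact ⟨2 * m, by lia, hlr⟩
    · obtain ⟨m, hm, hlr⟩ := exists_stair_odd_of_isCrossed_vertical hp h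
      exact ⟨2 * m + 1, by lia, hlr⟩
    · obtain ⟨m, hm, hlr⟩ := exists_stair_odd_of_isCrossed_horizontal hp h
      exact ⟨2 * m + 1, by lia, hlr⟩
  closer i _ := by
    rw [height_stair_add, sub_pos, stairCloser, decide_eq_true_iff]
    exact_mod_cast Iff.rfl
  link_right _ _ := stair_link_right hp
  link_left _ _ := stair_link_left hp

theorem kMarkov_eq_chainFenceCard (hp : 0 < p) {N : ℕ}
    (hN : N + 4 = 2 * (p + q) + if q = 0 then 1 else 0) (k : ℕ) :
    kMarkov k p q = chainFenceCard k (stairCloser p q) (stairLink p q) N :=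
  (segmentSequence_stair hp hN).kMarkov_eq (by simp; lia) k

theorem kMarkov_eq_one_of_add_eq_one (hpq : p + q = 1) (k : ℕ) : kMarkov k p q = 1 := by
  refine kMarkov_eq_one k (by simp; lia) fun l r h => ?_
  obtain ⟨x, y⟩ := r
  rcases h.left_eq (by lia) (by lia) with rfl | rfl | rfl
  · have := isCrossed_diagonal_iff.1 h
    lia
  · have := isCrossed_vertical_iff.1 h
    lia
  · have := isCrossed_horizontal_iff.1 h
    lia

theorem mul_ne_mul_of_coprime (hpq : p.Coprime q) {s : ℕ} (hs : 0 < s) (hs' : s < p + q) (y : ℕ) :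
    (p + q) * y ≠ q * s := by
  intro h
  have coprime : (p + q).Coprime q := by simpa using hpq
  exact Nat.not_dvd_of_pos_of_lt hs hs' (coprime.dvd_of_dvd_mul_left ⟨y, h.symm⟩)

theorem rise_add_rise (hp : 0 < p) (hpq : p.Coprime q) {s t : ℕ} (hs : 0 < s) (ht : 0 < t)
    (hst : s + t = p + q) : rise p q s + rise p q t + 1 = q := by
  obtain ⟨le, lt⟩ := rise_spec (q := q) hp s
  replace le := lt_of_le_of_ne le (mul_ne_mul_of_coprime hpq hs (by lia) (rise p q s))
  generalize rise p q s = y at *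
  have s_le : s ≤ p + q := by lia
  have y_lt : y < q := by nlinarith
  obtain ⟨z, rfl⟩ := Nat.exists_eq_add_of_lt y_lt
  suffices rise p (y + z + 1) t = z by lia
  have mul_add_mul : (y + z + 1) * s + (y + z + 1) * t = (y + z + 1) * (p + (y + z + 1)) := by
    rw [← mul_add, hst]
  exact (rise_eq_iff hp).2 ⟨by nlinarith, by nlinarith⟩

theorem stairCloser_two_mul_sub (hp : 0 < p) (hpq : p.Coprime q) {m i : ℕ} (hm : m + 2 = p + q)
    (hi : i < m) : stairCloser p q (2 * m - i) = !stairCloser p q i := by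
  obtain ⟨j, hj⟩ : ∃ j, j + i = 2 * m := ⟨2 * m - i, by lia⟩
  have rise_add := rise_add_rise hp hpq (s := i / 2 + 1) (t := (j + 1) / 2 + 1)
    (by lia) (by lia) (by lia)
  have rise_add' := rise_add_rise hp hpq (s := (i + 1) / 2 + 1) (t := j / 2 + 1)
    (by lia) (by lia) (by lia)
  have ne := mul_ne_mul_of_coprime hpq (s := i + 2) (by lia) (by lia)
    (rise p q (i / 2 + 1) + rise p q ((i + 1) / 2 + 1) + 1)
  rw [show 2 * m - i = j by lia, stairCloser, stairCloser, ← decide_not, decide_eq_decide, not_lt]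
  have width_add : q * (i + 2) + q * (j + 2) = 2 * q * (p + q) := by
    rw [← mul_add, show i + 2 + (j + 2) = 2 * (p + q) by lia]
    ring
  have rise_sum_add : (p + q) * (rise p q (i / 2 + 1) + rise p q ((i + 1) / 2 + 1) + 1) +
      (p + q) * (rise p q (j / 2 + 1) + rise p q ((j + 1) / 2 + 1) + 1) = 2 * q * (p + q) := by
    linear_combination (p + q) * (rise_add + rise_add')
  lia

theorem stairLink_two_mul_sub (hp : 0 < p) (hpq : p.Coprime q) {m i : ℕ} (hm : m + 2 = p + q)
    (hi : i < m) : stairLink p q (2 * m - 1 - i) = !stairLink p q i := by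
  obtain ⟨j, hj⟩ : ∃ j, j + i + 1 = 2 * m := ⟨2 * m - 1 - i, by lia⟩
  have rise_add := rise_add_rise hp hpq (s := i / 2 + 1) (t := j / 2 + 2)
    (by lia) (by lia) (by lia)
  have rise_add' := rise_add_rise hp hpq (s := i / 2 + 2) (t := j / 2 + 1)
    (by lia) (by lia) (by lia)
  rw [show 2 * m - 1 - i = j by lia, stairLink, stairLink, ← decide_not, decide_eq_decide]
  lia

theorem stairCloser_middle (hp : 0 < p) (hpq : p.Coprime q) {m : ℕ} (hm : m + 2 = p + q) :
    stairCloser p q m = false := by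
  have rise_add := rise_add_rise hp hpq (s := m / 2 + 1) (t := (m + 1) / 2 + 1)
    (by lia) (by lia) (by lia)
  rw [stairCloser, rise_add, hm, mul_comm, decide_eq_false_iff_not]
  exact lt_irrefl _

theorem kMarkov_eq_halfForm (hp : 0 < p) (hq : 0 < q) (hpq : p.Coprime q) {m : ℕ}
    (hm : m + 2 = p + q) (k : ℕ) :
    kMarkov k p q = halfForm k (chainVec k (stairCloser p q) (stairLink p q) m) := by
  rw [kMarkov_eq_chainFenceCard (N := 2 * m) hp (by rw [if_neg hq.ne']; lia),
    chainFenceCard_eq_halfForm (stairCloser_middle hp hpq hm)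
      (fun _ => stairCloser_two_mul_sub hp hpq hm) (fun _ => stairLink_two_mul_sub hp hpq hm)]

end Staircase

section Row

/-- The directions of the links of the fences of `γ^L_{(n,0)}` and `γ^L_{(n,1)}`. -/
def rowLink (i : ℕ) : Bool := i % 2 = 0

/-- The vectors `chainVec` along `γ^L_{(n,0)}`, at every second crossing. -/
def rowVec (k : ℕ) : ℕ → ℕ × ℕ
  | 0 => (1, 1)
  | n + 1 => ((2 * k + 2) * (rowVec k n).1 + (rowVec k n).2,
      (2 * k + 1) * (rowVec k n).1 + (rowVec k n).2)

theorem rowVec_add_succ_fst (k s t : ℕ) : (rowVec k (s + t + 1)).1 =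
    ((2 * k + 1) * (rowVec k s).1 + (rowVec k s).2) * (rowVec k t).1 +
      (rowVec k s).1 * (rowVec k t).2 := by
  induction s generalizing t with
  | zero => simp [rowVec]
  | succ s ih =>
    rw [show s + 1 + t + 1 = s + (t + 1) + 1 by ring, ih (t + 1)]
    simp only [rowVec]
    ring

theorem chainVec_row_even_succ (k n : ℕ) : chainVec k (fun _ => true) rowLink (2 * n + 1) =
    ((chainVec k (fun _ => true) rowLink (2 * n)).1,
      (chainVec k (fun _ => true) rowLink (2 * n)).2 +
        (k + 1) * (chainVec k (fun _ => true) rowLink (2 * n)).1) := by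
  rw [chainVec, show rowLink (2 * n) = true by simp [rowLink], fenceStep_true_iterate]
  simp only [fenceStep, cond_true, Prod.mk.injEq, true_and]
  ring

theorem chainVec_row_even (k n : ℕ) :
    chainVec k (fun _ => true) rowLink (2 * n) = rowVec k n := by
  induction n with
  | zero => rfl
  | succ n ih =>
    rw [show 2 * (n + 1) = 2 * n + 1 + 1 by ring, chainVec, chainVec_row_even_succ, ih,
      fenceStep_true_iterate, show rowLink (2 * n + 1) = false by simp [rowLink]]
    simp only [fenceStep, rowVec, cond_false, Prod.mk.injEq]
    constructor <;> ring

theorem chainVec_row_odd (k n : ℕ) : chainVec k (fun _ => true) rowLink (2 * n + 1) =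
    ((rowVec k n).1, (rowVec k n).2 + (k + 1) * (rowVec k n).1) := by
  rw [chainVec_row_even_succ, chainVec_row_even]

theorem halfForm_row_succ (k n : ℕ) :
    halfForm k (chainVec k (fun _ => true) rowLink (n + 1)) =
      (k + 1) * (rowVec k (n + 1)).1 + halfForm k (chainVec k (fun _ => true) rowLink n) := by
  obtain ⟨i, rfl | rfl⟩ := n.even_or_odd'
  · rw [chainVec_row_even, chainVec_row_odd, show 2 * i + 1 = i + i + 1 by ring,
      rowVec_add_succ_fst]
    simp only [halfForm]
    ring
  · rw [show 2 * i + 1 + 1 = 2 * (i + 1) by ring, chainVec_row_odd, chainVec_row_even,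
      show 2 * (i + 1) = i + 1 + i + 1 by ring, rowVec_add_succ_fst]
    simp only [halfForm, rowVec]
    ring

theorem rise_zero_right (p s : ℕ) : rise p 0 s = 0 := by simp [rise]

theorem rise_one_right {p s : ℕ} (hs : s ≤ p) : rise p 1 s = 0 := by
  rw [rise, one_mul, Nat.div_eq_of_lt (by lia)]

theorem kMarkov_succ_zero (k n : ℕ) : kMarkov k (n + 1) 0 = (rowVec k n).1 := by
  obtain _ | n := n
  · exact_mod_cast kMarkov_eq_one_of_add_eq_one (p := 1) (q := 0) rfl k
  have := kMarkov_eq_chainFenceCard (p := n + 2) (q := 0) (N := 2 * n + 1) (by lia) (by simp; lia) k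
  rw [chainFenceCard_congr (d' := fun _ => true) (s' := rowLink)
    (fun i _ => by simp [stairCloser, rise_zero_right])
    (fun i _ => by simp [stairLink, rowLink, rise_zero_right]), chainFenceCard, chainVec_row_odd,
    fenceStep_true_iterate] at this
  push_cast at this ⊢
  rw [add_assoc, one_add_one_eq_two, this]
  simp only [rowVec]
  ring

theorem kMarkov_succ_one (k n : ℕ) :
    kMarkov k (n + 1) 1 = halfForm k (chainVec k (fun _ => true) rowLink n) := by
  rw [← chainVec_congr (d := stairCloser (n + 1) 1) (s := stairLink (n + 1) 1)]
  · exact_mod_cast kMarkov_eq_halfForm (p := n + 1) (q := 1) (m := n) (by lia) (by lia)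
      (Nat.coprime_one_right _) rfl k
  · intro i hi
    rw [stairCloser, rise_one_right (by lia), rise_one_right (by lia)]
    exact decide_eq_true (by lia)
  · intro i hi
    rw [stairLink, rise_one_right (by lia), rise_one_right (by lia), rowLink]
    simp

theorem kMarkov_one_recurrence (k n : ℕ) :
    kMarkov k (n + 1) 1 = (k + 1) * kMarkov k (n + 1) 0 + kMarkov k n 1 := by
  rw [kMarkov_succ_one, kMarkov_succ_zero]
  obtain _ | n := n
  · rw [show kMarkov k (0 : ℕ) 1 = 1 from mod_cast kMarkov_eq_one_of_add_eq_one (p := 0) rfl k]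
    simp only [chainVec, halfForm, rowVec]
    ring
  · push_cast
    rw [kMarkov_succ_one, halfForm_row_succ]

end Row

section Diagonal

/-- The directions of the chains of the fence of `γ^L_{(n,n)}`; those in the first half of the fence
of `γ^L_{(n+1,n)}` are opposite. -/
def diagCloser (i : ℕ) : Bool := i % 4 ≠ 0

/-- The directions of the links of the fence of `γ^L_{(n,n)}`; those of the fence of
`γ^L_{(n+1,n)}` are opposite. -/
def diagLink (i : ℕ) : Bool := i % 4 = 1 ∨ i % 4 = 2

/-- The linear recursion that governs the vectors `chainVec` along `γ^L_{(n,n)}` and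
`γ^L_{(n+1,n)}`. -/
def diagVec (k : ℕ) : ℕ → ℕ × ℕ
  | 0 => (1, 0)
  | n + 1 => ((diagVec k n).1 + (3 * k + 2) * ((diagVec k n).2 + (k + 2) * (diagVec k n).1),
      (diagVec k n).2 + (k + 2) * (diagVec k n).1)

theorem diagVec_add_succ_snd (k s t : ℕ) : (diagVec k (s + t + 1)).2 =
    (diagVec k s).1 * (diagVec k (t + 1)).2 + (diagVec k s).2 * (diagVec k t).1 := by
  induction s generalizing t with
  | zero => simp [diagVec]
  | succ s ih =>
    rw [show s + 1 + t + 1 = s + (t + 1) + 1 by ring, ih (t + 1)]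
    simp only [diagVec]
    ring

theorem chainVec_diag_add_one (k n : ℕ) : chainVec k diagCloser diagLink (4 * n + 1) =
    ((chainVec k diagCloser diagLink (4 * n)).1 +
      (k + 1) * (chainVec k diagCloser diagLink (4 * n)).2,
      (chainVec k diagCloser diagLink (4 * n)).2) := by
  rw [chainVec, show diagCloser (4 * n) = false by simp [diagCloser],
    show diagLink (4 * n) = false by simp [diagLink], fenceStep_false_iterate]
  simp only [fenceStep, cond_false, Prod.mk.injEq, and_true]
  ring

theorem chainVec_diag_add_three (k n : ℕ) : chainVec k diagCloser diagLink (4 * n + 3) =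
    ((chainVec k diagCloser diagLink (4 * n + 1)).1,
      (chainVec k diagCloser diagLink (4 * n + 1)).2 +
        (2 * k + 2) * (chainVec k diagCloser diagLink (4 * n + 1)).1) := by
  rw [chainVec, chainVec, show diagCloser (4 * n + 1) = true by simp [diagCloser],
    show diagCloser (4 * n + 2) = true by simp [diagCloser],
    show diagLink (4 * n + 1) = true by simp [diagLink],
    show diagLink (4 * n + 2) = true by simp [diagLink], fenceStep_true_iterate,
    fenceStep_true_iterate]
  simp only [fenceStep, cond_true, Prod.mk.injEq, true_and]
  ring

theorem chainVec_diag_zero (k n : ℕ) : chainVec k diagCloser diagLink (4 * n) =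
    ((diagVec k n).1 + (diagVec k n).2, (diagVec k n).1) := by
  induction n with
  | zero => rfl
  | succ n ih =>
    rw [show 4 * (n + 1) = 4 * n + 3 + 1 by ring, chainVec, chainVec_diag_add_three,
      chainVec_diag_add_one, ih, show diagCloser (4 * n + 3) = true by simp [diagCloser],
      show diagLink (4 * n + 3) = false by simp [diagLink], fenceStep_true_iterate]
    simp only [fenceStep, cond_false, diagVec, Prod.mk.injEq]
    constructor <;> ring

theorem chainVec_diag_one (k n : ℕ) : chainVec k diagCloser diagLink (4 * n + 1) =
    ((diagVec k (n + 1)).2, (diagVec k n).1) := by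
  rw [chainVec_diag_add_one, chainVec_diag_zero]
  simp only [diagVec, Prod.mk.injEq, and_true]
  ring

theorem chainVec_diag_three (k n : ℕ) : chainVec k diagCloser diagLink (4 * n + 3) =
    ((diagVec k (n + 1)).2, (diagVec k n).1 + (2 * k + 2) * (diagVec k (n + 1)).2) := by
  rw [chainVec_diag_add_three, chainVec_diag_one]

theorem halfForm_diag_add_two (k n : ℕ) :
    halfForm k (chainVec k diagCloser diagLink (2 * n + 3)) =
      2 * (k + 1) * (diagVec k (n + 2)).2 +
        halfForm k (chainVec k diagCloser diagLink (2 * n + 1)) := by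
  obtain ⟨i, rfl | rfl⟩ := n.even_or_odd'
  · rw [show 2 * (2 * i) + 3 = 4 * i + 3 by ring, show 2 * (2 * i) + 1 = 4 * i + 1 by ring,
      chainVec_diag_one, chainVec_diag_three, show 2 * i + 2 = i + 1 + i + 1 by ring,
      diagVec_add_succ_snd]
    simp only [halfForm, diagVec]
    ring
  · rw [show 2 * (2 * i + 1) + 3 = 4 * (i + 1) + 1 by ring,
      show 2 * (2 * i + 1) + 1 = 4 * i + 3 by ring, chainVec_diag_one, chainVec_diag_three,
      show 2 * i + 1 + 2 = i + 1 + (i + 1) + 1 by ring, diagVec_add_succ_snd k (i + 1) (i + 1)]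
    simp only [halfForm, diagVec]
    ring

theorem rise_self {n : ℕ} (hn : 0 < n) (s : ℕ) : rise n n s = s / 2 := by
  rw [rise, ← two_mul, mul_comm 2, Nat.mul_div_mul_left _ _ hn]

theorem rise_succ_self {n s : ℕ} (hs : s ≤ 2 * n) : rise (n + 1) n (s + 1) = s / 2 := by
  rw [rise_eq_iff n.succ_pos]
  obtain ⟨y, rfl | rfl⟩ := s.even_or_odd'
  · rw [show 2 * y / 2 = y by lia]
    constructor <;> nlinarith
  · rw [show (2 * y + 1) / 2 = y by lia]
    constructor <;> nlinarith

theorem kMarkov_self (k n : ℕ) : kMarkov k (n + 1) (n + 1) = (diagVec k (n + 1)).2 := by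
  have := kMarkov_eq_chainFenceCard (p := n + 1) (q := n + 1) (N := 4 * n) (by lia)
    (by rw [if_neg n.succ_ne_zero]; lia) k
  push_cast at this
  rw [this, chainFenceCard_congr (d' := diagCloser) (s' := diagLink), chainFenceCard,
    chainVec_diag_zero, show diagCloser (4 * n) = false by simp [diagCloser],
    fenceStep_false_iterate]
  · simp only [diagVec]
    ring
  · intro i _
    rw [stairCloser, rise_self n.succ_pos, rise_self n.succ_pos, diagCloser, decide_eq_decide,
      ← two_mul, mul_comm 2, mul_assoc, Nat.mul_lt_mul_left n.succ_pos]
    lia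
  · intro i _
    rw [stairLink, rise_self n.succ_pos, rise_self n.succ_pos, diagLink, decide_eq_decide]
    lia

theorem stairCloser_succ_self {n i : ℕ} (hi : i < 2 * n - 1) :
    stairCloser (n + 1) n i = !diagCloser i := by
  rw [stairCloser, rise_succ_self (by lia), rise_succ_self (by lia), diagCloser, ← decide_not,
    decide_eq_decide]
  obtain ⟨j, rfl | rfl | rfl | rfl⟩ :
      ∃ j, i = 4 * j ∨ i = 4 * j + 1 ∨ i = 4 * j + 2 ∨ i = 4 * j + 3 := ⟨i / 4, by lia⟩
  · rw [show 4 * j / 2 / 2 = j by lia, show (4 * j + 1) / 2 / 2 = j by lia]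
    lia
  · rw [show (4 * j + 1) / 2 / 2 = j by lia, show (4 * j + 1 + 1) / 2 / 2 = j by lia]
    lia
  · rw [show (4 * j + 2) / 2 / 2 = j by lia, show (4 * j + 2 + 1) / 2 / 2 = j by lia]
    lia
  · rw [show (4 * j + 3) / 2 / 2 = j by lia, show (4 * j + 3 + 1) / 2 / 2 = j + 1 by lia]
    lia

theorem stairLink_succ_self {n i : ℕ} (hi : i < 2 * n - 1) :
    stairLink (n + 1) n i = !diagLink i := by
  rw [stairLink, rise_succ_self (by lia), rise_succ_self (by lia), diagLink, ← decide_not,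
    decide_eq_decide]
  lia

theorem kMarkov_succ_self (k n : ℕ) : kMarkov k (n + 2) (n + 1) =
    halfForm k (chainVec k diagCloser diagLink (2 * n + 1)) := by
  rw [← halfForm_swap, ← chainVec_not,
    ← chainVec_congr (fun i hi => stairCloser_succ_self (n := n + 1) (by lia))
      (fun i hi => stairLink_succ_self (n := n + 1) (by lia))]
  exact_mod_cast kMarkov_eq_halfForm (p := n + 2) (q := n + 1) (by lia) (by lia)
    ((Nat.coprime_self_add_left (n := 1)).2 (Nat.coprime_one_left _)) (by lia) k

theorem kMarkov_self_recurrence (k n : ℕ) : kMarkov k (n + 2) (n + 1) =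
    2 * (k + 1) * kMarkov k (n + 1) (n + 1) + kMarkov k (n + 1) n := by
  rw [kMarkov_succ_self, kMarkov_self]
  obtain _ | n := n
  · rw [show kMarkov k ((0 : ℕ) + 1) (0 : ℕ) = 1 from
      mod_cast kMarkov_eq_one_of_add_eq_one (p := 1) rfl k, mul_zero, ← mul_zero 4,
      chainVec_diag_one]
    simp only [halfForm, diagVec]
    ring
  · rw [mul_add_one, add_assoc, halfForm_diag_add_two, Nat.cast_succ, add_assoc (n : ℤ),
      one_add_one_eq_two, kMarkov_succ_self]

end Diagonal

theorem proposition4 (k n : ℕ) (hn : 1 ≤ n) :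
    kMarkov k n 1 = (k + 1) * kMarkov k n 0 + kMarkov k ((n : ℤ) - 1) 1 ∧
      kMarkov k ((n : ℤ) + 1) n = 2 * (k + 1) * kMarkov k n n + kMarkov k n ((n : ℤ) - 1) := by
  obtain ⟨m, rfl⟩ := Nat.exists_eq_add_of_le' hn
  rw [Nat.cast_succ, add_sub_cancel_right, add_assoc, one_add_one_eq_two]
  exact ⟨kMarkov_one_recurrence k m, kMarkov_self_recurrence k m⟩
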